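/- Let $n\ge 1$ and let $A=[a_{ij}]$ be an $n\times n$ pairwise comparison matrix, i.e. $a_{ij}>0$ and $a_{ji}=1/a_{ij}$ for all $i,j$. The LWAE problem is to minimize $G_\infty(A,v)=\max_{i,j}|a_{ij}-v_i/v_j|$ over $v\in\mathbb R^n$ with $v_j>0$ for all $j$ and $v_1=1$. For $z\ge 0$ put $l_{ij}(z)=-\ln\max\{a_{ij}-z,\ 1/(a_{ji}+z)\}$. A *reduced problem* is given by a partition of $\{1,\dots,n\}$ into sets $C_i$, each named by a reference vertex $i\in C_i$, and by constants $c_k$ with $c_i=0$ for each reference vertex $i$; it arises from the substitution $w_k=c_k+w_i$ $(k\in C_i)$, where $w_k=\ln v_k$. Its network has the reference vertices as nodes and arc lengths $l^\star_{ij}(z)=\min\{l_{pq}(z)+c_p-c_q : p\in C_i,\ q\in C_j\}$ for $i\ne j$. To solve it is to find $w$ (indexed by the reference vertices) and the smallest $z\ge0$ such that $w_j-w_i\le l^\star_{ij}(z)$ for all reference vertices $i\neq j$, and $w_1=0$ (where $w_1=c_1+w_i$ for the reference vertex $i$ with $1\in C_i$). The binding digraph $D$ of a solution $(w,z)$ has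 the reference vertices as nodes and an arc $(i,j)$, $i\ne j$, whenever $w_j-w_i=l^\star_{ij}(z)$. Consider the following algorithm, in which all problems are solved exactly. 1. Start with $C_i=\{i\}$ and $c_i=0$ for all $i$ (this is the LWAE problem itself in logarithmic form), and take any solution $(w,z)$. 2. If the binding digraph $D$ of $(w,z)$ is strongly connected, go to 4; otherwise go to 3. 3. In each strongly connected component $C$ of $D$ choose any vertex $i$; replace the sets $C_j$, $j\in C$, by their union, with reference vertex $i$; recompute the constants $c_k$ as $w_k-w_i$ for $k$ in this union, where $w_k$ is the value given by the current solution. Take any solution $(w,z)$ of the new reduced problem and go to 2. 4. Return the vector $v$ with $v_k=e^{c_k}e^{w_i}$ for $k\in C_i$. Then every reduced problem that occurs has a solution, every run of the algorithm stops after finitely many steps, the last reduced problem of a run has only one solution, and all runs (for all choices made) return the same vector $v$. This $v$ is an optimal solution of the LWAE problem, and it is Pareto-optimal for the vector problem $\min_{v\in\mathbb R^n_{++}}(|a_{ij}-v_i/v_j|)_{i,j}$: there is no positive vector $u$ with $|a_{ij}-u_i/u_j|\le|a_{ij}-v_i/v_j|$ for all $i,j$ and with strict inequality for some $i,j$. 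-/

import Mathlib

namespace LWAE

/-- A pairwise comparison matrix: positive entries, `a_ji = 1 / a_ij`. -/
structure IsPCM {n : ℕ} (A : Matrix (Fin n) (Fin n) ℝ) : Prop where
  pos : ∀ i j, 0 < A i j
  recip : ∀ i j, A j i = 1 / A i j

/-- The deviation `|a_ij - v_i / v_j|`. -/
noncomputable def dev {n : ℕ} (A : Matrix (Fin n) (Fin n) ℝ) (v : Fin n → ℝ) (i j : Fin n) : ℝ :=
  |A i j - v i / v j|

/-- `G_∞(A, v)`, the largest deviation. -/
noncomputable def Ginf {n : ℕ} [NeZero n] (A : Matrix (Fin n) (Fin n) ℝ) (v : Fin n → ℝ) : ℝ :=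
  Finset.univ.sup' Finset.univ_nonempty (fun p : Fin n × Fin n => dev A v p.1 p.2)

/-- `v` is an optimal solution of the LWAE problem: minimize `G_∞(A, v)` over the positive vectors
whose first coordinate is `1`. The first decision variant is the index `0`. -/
def IsLWAEOptimal {n : ℕ} [NeZero n] (A : Matrix (Fin n) (Fin n) ℝ) (v : Fin n → ℝ) : Prop :=
  (∀ i, 0 < v i) ∧ v 0 = 1 ∧
    ∀ u : Fin n → ℝ, (∀ i, 0 < u i) → u 0 = 1 → Ginf A v ≤ Ginf A u

/-- `v` is a Pareto-optimal (efficient) solution of the vector problem of minimizing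
`(|a_ij - v_i / v_j|)_{i,j}` over all positive vectors. -/
def IsParetoOptimal {n : ℕ} (A : Matrix (Fin n) (Fin n) ℝ) (v : Fin n → ℝ) : Prop :=
  (∀ i, 0 < v i) ∧
    ¬ ∃ u : Fin n → ℝ, (∀ i, 0 < u i) ∧ (∀ i j, dev A u i j ≤ dev A v i j) ∧
      ∃ i j, dev A u i j < dev A v i j

/-- `l_ij(z) = -ln max {a_ij - z, 1 / (a_ji + z)}`, used for `z ≥ 0`. -/
noncomputable def len {n : ℕ} (A : Matrix (Fin n) (Fin n) ℝ) (i j : Fin n) (z : ℝ) : ℝ :=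
  -Real.log (max (A i j - z) (1 / (A j i + z)))

/-- The data of a reduced problem: a partition of the `n` original vertices into sets with
one reference vertex each, and constants `c_k`, expressing the substitution `w_k = c_k + w_i` for
`k ∈ C_i`. The partition is given by the map `ref` that sends `k` to the reference vertex of
its set, so the reference vertices are the fixed points of `ref`, and `C_i = {k | ref k = i}`. -/
structure Reduction (n : ℕ) where
  ref : Fin n → Fin n
  ref_ref : ∀ k, ref (ref k) = ref k
  c : Fin n → ℝ
  c_ref : ∀ k, c (ref k) = 0

namespace Reduction

/-- The unreduced problem: `C_i = {i}` for every `i`. -/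
def initial (n : ℕ) : Reduction n where
  ref := fun k => k
  ref_ref := fun _ => rfl
  c := fun _ => 0
  c_ref := fun _ => rfl

/-- The vertices of the reduced network: the reference vertices. -/
def Vertex {n : ℕ} (S : Reduction n) : Type := {i : Fin n // S.ref i = i}

/-- The reference vertex of the set that contains `k`, as a vertex of the reduced network. -/
def vertexOf {n : ℕ} (S : Reduction n) (k : Fin n) : S.Vertex := ⟨S.ref k, S.ref_ref k⟩

/-- All `n` logarithmic weights from those of the reference vertices: `w_k = c_k + w_i`. -/
def expand {n : ℕ} (S : Reduction n) (w : S.Vertex → ℝ) (k : Fin n) : ℝ :=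
  S.c k + w (S.vertexOf k)

/-- The arc length of the reduced network,
`l*_ij(z) = min {l_pq(z) + c_p - c_q | p ∈ C_i, q ∈ C_j}` (the set is finite and nonempty). -/
noncomputable def redLen {n : ℕ} (A : Matrix (Fin n) (Fin n) ℝ) (S : Reduction n)
    (i j : S.Vertex) (z : ℝ) : ℝ :=
  sInf {x : ℝ | ∃ p q : Fin n, S.ref p = i.1 ∧ S.ref q = j.1 ∧ x = len A p q z + S.c p - S.c q}

/-- `(w, z)` is feasible for the reduced problem: `w_j - w_i ≤ l*_ij(z)` for all pairs of distinct
reference vertices, `z ≥ 0`, and the normalization `w_1 = 0` of the original problem (after the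
substitution). -/
def Feasible {n : ℕ} [NeZero n] (A : Matrix (Fin n) (Fin n) ℝ) (S : Reduction n)
    (w : S.Vertex → ℝ) (z : ℝ) : Prop :=
  0 ≤ z ∧ S.expand w 0 = 0 ∧ ∀ i j : S.Vertex, i ≠ j → w j - w i ≤ S.redLen A i j z

/-- `(w, z)` solves the reduced problem: it is feasible, with the smallest possible `z`. -/
def IsSolution {n : ℕ} [NeZero n] (A : Matrix (Fin n) (Fin n) ℝ) (S : Reduction n)
    (w : S.Vertex → ℝ) (z : ℝ) : Prop :=
  S.Feasible A w z ∧ ∀ (w' : S.Vertex → ℝ) (z' : ℝ), S.Feasible A w' z' → z ≤ z'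

/-- The digraph `D` of the binding inequalities. -/
def bindingDigraph {n : ℕ} (A : Matrix (Fin n) (Fin n) ℝ) (S : Reduction n)
    (w : S.Vertex → ℝ) (z : ℝ) : Digraph S.Vertex where
  Adj i j := i ≠ j ∧ w j - w i = S.redLen A i j z

end Reduction

/-- `i` and `j` lie in the same strongly connected component of `D`. -/
def SameSCC {V : Type*} (D : Digraph V) (i j : V) : Prop :=
  Relation.ReflTransGen D.Adj i j ∧ Relation.ReflTransGen D.Adj j i

/-- `D` is strongly connected. -/
def StronglyConnected {V : Type*} (D : Digraph V) : Prop := ∀ i j : V, SameSCC D i j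

/-- A configuration of the algorithm when it enters Step 2: the current reduced problem and
the pair `(w, z)` found for it. The weights of the reference vertices are `v_i = exp w_i`. -/
structure Config (n : ℕ) where
  red : Reduction n
  w : red.Vertex → ℝ
  z : ℝ

namespace Config

/-- The binding digraph `D(v, z)` of the current problem. -/
def digraph {n : ℕ} (A : Matrix (Fin n) (Fin n) ℝ) (γ : Config n) : Digraph γ.red.Vertex :=
  γ.red.bindingDigraph A γ.w γ.z

/-- Step 1: the unreduced problem together with any of its solutions. -/
def IsInitial {n : ℕ} [NeZero n] (A : Matrix (Fin n) (Fin n) ℝ) (γ : Config n) : Prop :=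
  γ.red = Reduction.initial n ∧ γ.red.IsSolution A γ.w γ.z

/-- The test of Step 2. -/
def Stops {n : ℕ} (A : Matrix (Fin n) (Fin n) ℝ) (γ : Config n) : Prop :=
  StronglyConnected (γ.digraph A)

/-- `S` arises from the problem of `γ` by contracting each strongly connected component of the
binding digraph. The new reference vertex of `k` is an old reference vertex, in the component of
the old reference vertex of `k`; one vertex is chosen in each component; the constants are
recomputed from `w_k = c_k + w_i`. -/
def Contracts {n : ℕ} (A : Matrix (Fin n) (Fin n) ℝ) (γ : Config n) (S : Reduction n) : Prop :=
  (∀ k, ∃ i : γ.red.Vertex, S.ref k = i.1 ∧ SameSCC (γ.digraph A) (γ.red.vertexOf k) i) ∧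
  (∀ k m, SameSCC (γ.digraph A) (γ.red.vertexOf k) (γ.red.vertexOf m) → S.ref k = S.ref m) ∧
  ∀ k, S.c k = γ.red.expand γ.w k - γ.red.expand γ.w (S.ref k)

/-- Step 3: if the algorithm does not stop, contract the components (with any choice of the new
reference vertices) and take any solution of the new problem. -/
def Step {n : ℕ} [NeZero n] (A : Matrix (Fin n) (Fin n) ℝ) (γ γ' : Config n) : Prop :=
  ¬ γ.Stops A ∧ γ.Contracts A γ'.red ∧ γ'.red.IsSolution A γ'.w γ'.z

/-- `γ` occurs in some run of the algorithm. -/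
def Reachable {n : ℕ} [NeZero n] (A : Matrix (Fin n) (Fin n) ℝ) (γ : Config n) : Prop :=
  ∃ γ₀ : Config n, γ₀.IsInitial A ∧ Relation.ReflTransGen (Step A) γ₀ γ

/-- Step 4: the vector of all weights, `v_k = c*_k v_i` with `c*_k = exp c_k`, for `k ∈ C_i`. -/
noncomputable def weights {n : ℕ} (γ : Config n) (k : Fin n) : ℝ :=
  Real.exp (γ.red.c k) * Real.exp (γ.w (γ.red.vertexOf k))

end Config

/-- Some run of the algorithm stops and returns `v`. -/
def IsOutput {n : ℕ} [NeZero n] (A : Matrix (Fin n) (Fin n) ℝ) (v : Fin n → ℝ) : Prop :=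
  ∃ γ : Config n, γ.Reachable A ∧ γ.Stops A ∧ v = γ.weights

end LWAE

/-! For `z ≥ 0`, the two opposite deviations of a pair are at most `z` exactly when `w = ln v`
satisfies the two opposite difference constraints with lengths `l_ij(z)`. Every reduced problem is
lifted to weights `y` on all `n` vertices (`LogFeasible`), so that solutions of successive problems
live in one space.

The key is rigidity. If `y` and `y'` are feasible for the same problem and the same `z`, then `y' -
y` cannot increase along an arc binding for `y`; it is therefore constant on each strongly connected
component. Hence the components and the recomputed constants do not depend on the solution taken,
and different runs stay equal up to the choice of reference vertices (`Contracts.similar`). If the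
digraph is strongly connected, the normalization leaves only one solution.

Each contraction really merges vertices (`exists_ne_sameSCC`). For `z = 0` all arcs bind. For `z >
0` and an acyclic digraph, a potential decreasing along the binding arcs perturbs `y` so that all
constraints become strict, and `z` could be lowered. This gives termination.

The final weights remain feasible for the first problem at its minimal `z`, which is
LWAE-optimality. A vector dominating them is, after scaling, feasible for every problem of the run:
rigidity forces the constants on it. Uniqueness in the last problem then makes it equal to the
output. -/

namespace LWAE

/-! ### Arc lengths and deviations -/

section Length

variable {n : ℕ} {A : Matrix (Fin n) (Fin n) ℝ}

theorem IsPCM.max_pos (hA : IsPCM A) (p q : Fin n) {z : ℝ} (hz : 0 ≤ z) :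
    0 < max (A p q - z) (1 / (A q p + z)) :=
  lt_max_of_lt_right (one_div_pos.2 (add_pos_of_pos_of_nonneg (hA.pos q p) hz))

theorem IsPCM.diag (hA : IsPCM A) (p : Fin n) : A p p = 1 := by
  have h := hA.recip p p
  have hp := hA.pos p p
  field_simp at h
  nlinarith

theorem len_zero_add (hA : IsPCM A) (p q : Fin n) : len A p q 0 + len A q p 0 = 0 := by
  have h : ∀ p q, len A p q 0 = -Real.log (A p q) := fun p q => by
    simp [len, hA.recip p q]
  rw [h, h, hA.recip p q, one_div, Real.log_inv]
  ring

theorem len_mono (hA : IsPCM A) (p q : Fin n) {z z' : ℝ} (hz : 0 ≤ z) (h : z ≤ z') :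
    len A p q z ≤ len A p q z' := by
  unfold len
  have hp := hA.pos q p
  refine neg_le_neg (Real.log_le_log (hA.max_pos p q (hz.trans h)) (max_le_max (by linarith) ?_))
  exact one_div_le_one_div_of_le (by linarith) (by linarith)

/-- Truncation at `0` keeps the denominator `a_qp + z` positive, so continuity holds on the whole
line. -/
theorem continuous_len_max (hA : IsPCM A) (p q : Fin n) :
    Continuous fun z : ℝ => len A p q (max z 0) := by
  unfold len
  have hp : ∀ z : ℝ, A q p + max z 0 ≠ 0 := fun z =>
    (add_pos_of_pos_of_nonneg (hA.pos q p) (le_max_right z 0)).ne'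
  refine (Continuous.log ?_ fun z => (hA.max_pos p q (le_max_right z 0)).ne').neg
  exact (continuous_const.sub (continuous_id.max continuous_const)).max
    (continuous_const.div (continuous_const.add (continuous_id.max continuous_const)) hp)

/-- The two terms of the maximum encode the lower half of the bound on the deviation at `(p, q)` and
the upper half of the one at `(q, p)`. Only the two opposite arcs together give full absolute
values. -/
theorem sub_le_len_iff (hA : IsPCM A) (y : Fin n → ℝ) (p q : Fin n) {z : ℝ} (hz : 0 ≤ z) :
    y q - y p ≤ len A p q z ↔
      A p q - z ≤ Real.exp (y p) / Real.exp (y q) ∧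
        Real.exp (y q) / Real.exp (y p) ≤ A q p + z := by
  have hp : 0 < A q p + z := add_pos_of_pos_of_nonneg (hA.pos q p) hz
  rw [len, le_neg, Real.log_le_iff_le_exp (hA.max_pos p q hz), max_le_iff, neg_sub, Real.exp_sub,
    one_div, inv_le_comm₀ hp (div_pos (Real.exp_pos _) (Real.exp_pos _)), inv_div]

theorem dev_le_iff (hA : IsPCM A) (y : Fin n → ℝ) (p q : Fin n) {z : ℝ} (hz : 0 ≤ z) :
    (dev A (fun k => Real.exp (y k)) p q ≤ z ∧ dev A (fun k => Real.exp (y k)) q p ≤ z) ↔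
      y q - y p ≤ len A p q z ∧ y p - y q ≤ len A q p z := by
  rw [sub_le_len_iff hA y p q hz, sub_le_len_iff hA y q p hz]
  simp only [dev, abs_le]
  constructor
  · rintro ⟨⟨h1, h2⟩, h3, h4⟩
    refine ⟨⟨?_, ?_⟩, ?_, ?_⟩ <;> linarith
  · rintro ⟨⟨h1, h2⟩, h3, h4⟩
    refine ⟨⟨?_, ?_⟩, ?_, ?_⟩ <;> linarith

theorem dev_self (hA : IsPCM A) {u : Fin n → ℝ} (hu : ∀ i, 0 < u i) (p : Fin n) :
    dev A u p p = 0 := by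
  simp [dev, hA.diag p, div_self (hu p).ne']

theorem dev_div_const (u : Fin n → ℝ) {t : ℝ} (ht : t ≠ 0) (p q : Fin n) :
    dev A (fun k => u k / t) p q = dev A u p q := by
  simp only [dev, div_div_div_cancel_right₀ ht]

theorem dev_le_Ginf [NeZero n] (u : Fin n → ℝ) (p q : Fin n) : dev A u p q ≤ Ginf A u :=
  Finset.le_sup' (fun p : Fin n × Fin n => dev A u p.1 p.2) (Finset.mem_univ (p, q))

theorem Ginf_nonneg [NeZero n] (u : Fin n → ℝ) : 0 ≤ Ginf A u :=
  (abs_nonneg _).trans (dev_le_Ginf u 0 0)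

theorem Ginf_le_iff [NeZero n] (u : Fin n → ℝ) (z : ℝ) :
    Ginf A u ≤ z ↔ ∀ p q, dev A u p q ≤ z := by
  simp [Ginf, Finset.sup'_le_iff]

end Length

/-! ### Reduced problems lifted to all vertices -/

namespace Reduction

section

variable {n : ℕ} {A : Matrix (Fin n) (Fin n) ℝ} {S T : Reduction n}

theorem vertexOf_val (i : S.Vertex) : S.vertexOf i.1 = i := Subtype.ext i.2

theorem vertexOf_eq_iff {p q : Fin n} : S.vertexOf p = S.vertexOf q ↔ S.ref p = S.ref q :=
  Subtype.ext_iff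

theorem ref_eq_val_iff {p : Fin n} {i : S.Vertex} : S.ref p = i.1 ↔ S.vertexOf p = i :=
  ⟨fun h => Subtype.ext h, fun h => congrArg Subtype.val h⟩

theorem c_val (i : S.Vertex) : S.c i.1 = 0 := by
  rw [← i.2]; exact S.c_ref _

theorem expand_val (w : S.Vertex → ℝ) (i : S.Vertex) : S.expand w i.1 = w i := by
  rw [expand, c_val, vertexOf_val, zero_add]

theorem expand_sub_ref (w : S.Vertex → ℝ) (k : Fin n) :
    S.expand w k - S.expand w (S.ref k) = S.c k := by
  have h : S.expand w (S.ref k) = w (S.vertexOf k) := expand_val w (S.vertexOf k)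
  rw [h, expand]; ring

theorem expand_injective {w w' : S.Vertex → ℝ} (h : S.expand w = S.expand w') : w = w' := by
  funext i
  rw [← expand_val w, ← expand_val w', h]

/-- The candidates in the minimum that defines the reduced arc length. -/
theorem redLen_set_finite (A : Matrix (Fin n) (Fin n) ℝ) (i j : S.Vertex) (z : ℝ) :
    {x : ℝ | ∃ p q : Fin n, S.ref p = i.1 ∧ S.ref q = j.1 ∧
      x = len A p q z + S.c p - S.c q}.Finite := by
  refine (Set.finite_range fun p : Fin n × Fin n =>
    len A p.1 p.2 z + S.c p.1 - S.c p.2).subset ?_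
  rintro x ⟨p, q, -, -, rfl⟩
  exact ⟨(p, q), rfl⟩

theorem redLen_mem (A : Matrix (Fin n) (Fin n) ℝ) (i j : S.Vertex) (z : ℝ) :
    ∃ p q : Fin n, S.ref p = i.1 ∧ S.ref q = j.1 ∧
      S.redLen A i j z = len A p q z + S.c p - S.c q :=
  Set.Nonempty.csInf_mem (s := {x : ℝ | ∃ p q : Fin n, S.ref p = i.1 ∧ S.ref q = j.1 ∧
    x = len A p q z + S.c p - S.c q}) ⟨_, i.1, j.1, i.2, j.2, rfl⟩ (redLen_set_finite A i j z)

theorem redLen_le (A : Matrix (Fin n) (Fin n) ℝ) (p q : Fin n) (z : ℝ) :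
    S.redLen A (S.vertexOf p) (S.vertexOf q) z ≤ len A p q z + S.c p - S.c q :=
  csInf_le (redLen_set_finite A _ _ z).bddBelow ⟨p, q, rfl, rfl, rfl⟩

/-- Feasibility of a reduced problem, expressed with the logarithmic weights of all vertices. -/
structure LogFeasible [NeZero n] (A : Matrix (Fin n) (Fin n) ℝ) (S : Reduction n)
    (y : Fin n → ℝ) (z : ℝ) : Prop where
  nonneg : 0 ≤ z
  normalized : y 0 = 0
  sub_ref : ∀ k, y k - y (S.ref k) = S.c k
  le_len : ∀ p q, S.ref p ≠ S.ref q → y q - y p ≤ len A p q z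

/-- The arcs of the binding digraph, lifted to all vertices; vertices with the same reference
vertex are joined to each other. -/
def Tight (A : Matrix (Fin n) (Fin n) ℝ) (S : Reduction n) (y : Fin n → ℝ) (z : ℝ)
    (p q : Fin n) : Prop :=
  S.ref p = S.ref q ∨ y q - y p = len A p q z

/-- `S` and `T` differ only in the choice of the reference vertices. -/
structure Similar (S T : Reduction n) : Prop where
  ref_iff : ∀ p q, S.ref p = S.ref q ↔ T.ref p = T.ref q
  c_sub : ∀ p q, S.ref p = S.ref q → S.c p - S.c q = T.c p - T.c q

theorem Similar.refl (S : Reduction n) : S.Similar S := ⟨fun _ _ => Iff.rfl, fun _ _ _ => rfl⟩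

theorem Similar.symm (h : S.Similar T) : T.Similar S :=
  ⟨fun p q => (h.ref_iff p q).symm, fun p q hpq => (h.c_sub p q ((h.ref_iff p q).2 hpq)).symm⟩

theorem Similar.tight_iff (h : S.Similar T) (y : Fin n → ℝ) (z : ℝ) (p q : Fin n) :
    S.Tight A y z p q ↔ T.Tight A y z p q := by
  rw [Tight, Tight, h.ref_iff]

/-- Reachability in the binding digraph, on all vertices. -/
def Reach (A : Matrix (Fin n) (Fin n) ℝ) (S : Reduction n) (y : Fin n → ℝ) (z : ℝ) :
    Fin n → Fin n → Prop :=
  Relation.ReflTransGen (S.Tight A y z)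

theorem Similar.reach_iff (h : S.Similar T) (y : Fin n → ℝ) (z : ℝ) (p q : Fin n) :
    S.Reach A y z p q ↔ T.Reach A y z p q := by
  have : S.Tight A y z = T.Tight A y z := by
    funext a b
    exact propext (h.tight_iff y z a b)
  rw [Reach, Reach, this]

theorem exists_tight_of_adj {w : S.Vertex → ℝ} {z : ℝ} {i j : S.Vertex}
    (h : (S.bindingDigraph A w z).Adj i j) :
    ∃ p q, S.vertexOf p = i ∧ S.vertexOf q = j ∧
      S.expand w q - S.expand w p = len A p q z := by
  obtain ⟨p, q, hp, hq, e⟩ := redLen_mem A i j z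
  rw [ref_eq_val_iff] at hp hq
  refine ⟨p, q, hp, hq, ?_⟩
  have h2 := h.2
  simp only [expand, hp, hq]
  linarith

variable [NeZero n]

theorem LogFeasible.sub_eq {y : Fin n → ℝ} {z : ℝ} (h : S.LogFeasible A y z) {p q : Fin n}
    (hpq : S.ref p = S.ref q) : y p - y q = S.c p - S.c q := by
  rw [← h.sub_ref p, ← h.sub_ref q, hpq]; ring

theorem Similar.logFeasible (h : S.Similar T) {y : Fin n → ℝ} {z : ℝ}
    (hy : S.LogFeasible A y z) : T.LogFeasible A y z where
  nonneg := hy.nonneg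
  normalized := hy.normalized
  sub_ref k := by
    have hk : S.ref k = S.ref (T.ref k) := (h.ref_iff _ _).2 (T.ref_ref k).symm
    rw [hy.sub_eq hk, h.c_sub _ _ hk, T.c_ref, sub_zero]
  le_len p q hpq := hy.le_len p q fun e => hpq ((h.ref_iff p q).1 e)

theorem feasible_iff_logFeasible {w : S.Vertex → ℝ} {z : ℝ} :
    S.Feasible A w z ↔ S.LogFeasible A (S.expand w) z := by
  constructor
  · rintro ⟨h0, h1, h2⟩
    refine ⟨h0, h1, expand_sub_ref w, fun p q hpq => ?_⟩
    have := (h2 (S.vertexOf p) (S.vertexOf q) fun e => hpq (vertexOf_eq_iff.1 e)).trans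
      (redLen_le A p q z)
    simp only [expand]
    linarith
  · intro h
    refine ⟨h.nonneg, h.normalized, fun i j hij => ?_⟩
    obtain ⟨p, q, hp, hq, e⟩ := redLen_mem A i j z
    have h1 := h.le_len p q fun e => hij (Subtype.ext (hp.symm.trans (e.trans hq)))
    rw [ref_eq_val_iff] at hp hq
    simp only [expand, hp, hq] at h1
    rw [e]
    linarith

theorem LogFeasible.expand_restrict {y : Fin n → ℝ} {z : ℝ} (h : S.LogFeasible A y z) :
    S.expand (fun i => y i.1) = y := by
  funext k
  have := h.sub_ref k
  simp only [expand, vertexOf]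
  linarith

theorem isSolution_iff {w : S.Vertex → ℝ} {z : ℝ} :
    S.IsSolution A w z ↔
      S.LogFeasible A (S.expand w) z ∧ ∀ y z', S.LogFeasible A y z' → z ≤ z' := by
  rw [IsSolution, feasible_iff_logFeasible]
  refine and_congr_right fun _ => ⟨fun h y z' hy => ?_, fun h w' z' hw => ?_⟩
  · refine h (fun i => y i.1) z' (feasible_iff_logFeasible.2 ?_)
    rwa [hy.expand_restrict]
  · exact h _ z' (feasible_iff_logFeasible.1 hw)

theorem adj_vertexOf_of_tight {w : S.Vertex → ℝ} {z : ℝ} (h : S.LogFeasible A (S.expand w) z)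
    {p q : Fin n} (hpq : S.ref p ≠ S.ref q)
    (ht : S.expand w q - S.expand w p = len A p q z) :
    (S.bindingDigraph A w z).Adj (S.vertexOf p) (S.vertexOf q) := by
  have hne : S.vertexOf p ≠ S.vertexOf q := fun e => hpq (vertexOf_eq_iff.1 e)
  refine ⟨hne, le_antisymm ((feasible_iff_logFeasible.2 h).2.2 _ _ hne) ?_⟩
  refine (redLen_le A p q z).trans ?_
  simp only [expand] at ht
  linarith

/-- A binding reduced arc comes from a tight arc between some members of the two classes, since the
minimum is attained; moves inside a class connect the endpoints of consecutive tight arcs. -/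
theorem reflTransGen_adj_iff_reach {w : S.Vertex → ℝ} {z : ℝ}
    (h : S.LogFeasible A (S.expand w) z) {p q : Fin n} :
    Relation.ReflTransGen (S.bindingDigraph A w z).Adj (S.vertexOf p) (S.vertexOf q) ↔
      S.Reach A (S.expand w) z p q := by
  constructor
  · have key : ∀ j, Relation.ReflTransGen (S.bindingDigraph A w z).Adj (S.vertexOf p) j →
        ∀ q, S.vertexOf q = j → S.Reach A (S.expand w) z p q := by
      intro j hj
      induction hj with
      | refl => exact fun q hq => .single (.inl (vertexOf_eq_iff.1 hq.symm))
      | tail _ hadj ih =>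
        intro q hq
        obtain ⟨a, b, ha, hb, hab⟩ := exists_tight_of_adj hadj
        exact ((ih a ha).tail (.inr hab)).tail (.inl (vertexOf_eq_iff.1 (hb.trans hq.symm)))
    exact fun hpq => key _ hpq q rfl
  · intro hpq
    induction hpq with
    | refl => exact .refl
    | @tail a b _ hab ih =>
      by_cases hr : S.ref a = S.ref b
      · rwa [← vertexOf_eq_iff.2 hr]
      · exact ih.tail (adj_vertexOf_of_tight h hr (hab.resolve_left hr))

/-- Vertices of the same strongly connected component, on all vertices. -/
theorem sameSCC_iff {w : S.Vertex → ℝ} {z : ℝ} (h : S.LogFeasible A (S.expand w) z)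
    {p q : Fin n} :
    SameSCC (S.bindingDigraph A w z) (S.vertexOf p) (S.vertexOf q) ↔
      S.Reach A (S.expand w) z p q ∧ S.Reach A (S.expand w) z q p := by
  rw [SameSCC, reflTransGen_adj_iff_reach h, reflTransGen_adj_iff_reach h]

theorem stronglyConnected_iff {w : S.Vertex → ℝ} {z : ℝ} (h : S.LogFeasible A (S.expand w) z) :
    StronglyConnected (S.bindingDigraph A w z) ↔ ∀ p q, S.Reach A (S.expand w) z p q := by
  constructor
  · exact fun hs p q => ((sameSCC_iff h).1 (hs _ _)).1
  · intro hs i j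
    rw [← vertexOf_val i, ← vertexOf_val j]
    exact (sameSCC_iff h).2 ⟨hs _ _, hs _ _⟩

/-! ### Rigidity of the solutions on the strongly connected components -/

/-- On a tight arc `y' q - y' p ≤ l_pq(z) = y q - y p`; inside a class both differences are
prescribed by `c`. -/
theorem LogFeasible.sub_le_sub_of_reach {y y' : Fin n → ℝ} {z : ℝ} (h : S.LogFeasible A y z)
    (h' : S.LogFeasible A y' z) {p q : Fin n} (hpq : S.Reach A y z p q) :
    y' q - y q ≤ y' p - y p := by
  induction hpq with
  | refl => exact le_rfl
  | @tail a b _ hab ih =>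
    refine le_trans ?_ ih
    by_cases hr : S.ref a = S.ref b
    · have h1 := h.sub_eq hr
      have h2 := h'.sub_eq hr
      linarith
    · have h1 := hab.resolve_left hr
      have h2 := h'.le_len a b hr
      linarith

theorem LogFeasible.sub_eq_sub_of_reach {y y' : Fin n → ℝ} {z : ℝ} (h : S.LogFeasible A y z)
    (h' : S.LogFeasible A y' z) {p q : Fin n} (hpq : S.Reach A y z p q)
    (hqp : S.Reach A y z q p) : y' q - y' p = y q - y p := by
  have h1 := h.sub_le_sub_of_reach h' hpq
  have h2 := h.sub_le_sub_of_reach h' hqp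
  linarith

theorem LogFeasible.reach_of_reach {y y' : Fin n → ℝ} {z : ℝ} (h : S.LogFeasible A y z)
    (h' : S.LogFeasible A y' z) {p q : Fin n} (hpq : S.Reach A y z p q)
    (hqp : S.Reach A y z q p) : S.Reach A y' z p q := by
  unfold Reach at hpq
  induction hpq using Relation.ReflTransGen.head_induction_on with
  | refl => exact .refl
  | @head a b hab hbq ih =>
    -- The return path keeps every intermediate vertex in the component, where `y'` has the same
    -- differences as `y`, so the arc stays tight.
    refine .head ?_ (ih (hqp.tail hab))
    refine hab.imp id fun e => ?_
    rw [← e]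
    exact h.sub_eq_sub_of_reach h' (.single hab) (hbq.trans hqp)

theorem LogFeasible.eq_of_forall_reach {y y' : Fin n → ℝ} {z : ℝ} (h : S.LogFeasible A y z)
    (h' : S.LogFeasible A y' z) (hs : ∀ p q, S.Reach A y z p q) : y' = y := by
  funext k
  have := h.sub_eq_sub_of_reach h' (hs 0 k) (hs k 0)
  rw [h.normalized, h'.normalized] at this
  linarith

/-! ### Existence of solutions -/

theorem isClosed_logFeasible (hA : IsPCM A) (S : Reduction n) :
    IsClosed {x : (Fin n → ℝ) × ℝ | S.LogFeasible A x.1 x.2} := by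
  have e : {x : (Fin n → ℝ) × ℝ | S.LogFeasible A x.1 x.2} =
      {x | 0 ≤ x.2} ∩ ({x | x.1 0 = 0} ∩ ((⋂ k, {x | x.1 k - x.1 (S.ref k) = S.c k}) ∩
        ⋂ p, ⋂ q, ⋂ (_ : S.ref p ≠ S.ref q),
          {x | x.1 q - x.1 p ≤ len A p q (max x.2 0)})) := by
    ext x
    simp only [Set.mem_ofPred_eq, Set.mem_inter_iff, Set.mem_iInter]
    constructor
    · rintro ⟨h0, h1, h2, h3⟩
      exact ⟨h0, h1, h2, by rwa [max_eq_left h0]⟩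
    · rintro ⟨h0, h1, h2, h3⟩
      exact ⟨h0, h1, h2, by rwa [max_eq_left h0] at h3⟩
  rw [e]
  refine (isClosed_le continuous_const continuous_snd).inter
    ((isClosed_eq (by fun_prop) continuous_const).inter (IsClosed.inter ?_ ?_))
  · exact isClosed_iInter fun k => isClosed_eq (by fun_prop) continuous_const
  · exact isClosed_iInter fun p => isClosed_iInter fun q => isClosed_iInter fun _ =>
      isClosed_le (by fun_prop) ((continuous_len_max hA p q).comp continuous_snd)

/-- Compactness: as `y 0 = 0`, the constraints to and from vertex `0` bound every coordinate once `z
≤ Z`. -/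
theorem LogFeasible.exists_isSolution (hA : IsPCM A) {y : Fin n → ℝ} {Z : ℝ}
    (hy : S.LogFeasible A y Z) : ∃ (w : S.Vertex → ℝ) (z : ℝ), S.IsSolution A w z := by
  -- The second terms serve the vertices in the class of `0`, whose weights are fixed by `c` and
  -- carry no arc constraint with `0`.
  let f : Fin n → ℝ := fun k => min (-len A k 0 Z) (S.c k - S.c 0)
  let g : Fin n → ℝ := fun k => max (len A 0 k Z) (S.c k - S.c 0)
  have hK : IsCompact ((Set.Icc f g ×ˢ Set.Icc 0 Z) ∩
      {x : (Fin n → ℝ) × ℝ | S.LogFeasible A x.1 x.2}) :=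
    (isCompact_Icc.prod isCompact_Icc).inter_right (isClosed_logFeasible hA S)
  have hmem : ∀ y z, S.LogFeasible A y z → z ≤ Z →
      (y, z) ∈ (Set.Icc f g ×ˢ Set.Icc 0 Z) ∩
        {x : (Fin n → ℝ) × ℝ | S.LogFeasible A x.1 x.2} := by
    intro y z h hz
    have key : ∀ k, f k ≤ y k ∧ y k ≤ g k := by
      intro k
      have h0 := h.normalized
      by_cases hr : S.ref k = S.ref 0
      · have := h.sub_eq hr
        rw [h0, sub_zero] at this
        exact ⟨this ▸ min_le_right _ _, this ▸ le_max_right _ _⟩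
      · have h1 := (h.le_len k 0 hr).trans (len_mono hA k 0 h.nonneg hz)
        have h2 := (h.le_len 0 k (Ne.symm hr)).trans (len_mono hA 0 k h.nonneg hz)
        exact ⟨(min_le_left _ _).trans (by linarith),
          le_trans (by linarith) (le_max_left _ _)⟩
    exact ⟨⟨⟨fun k => (key k).1, fun k => (key k).2⟩, h.nonneg, hz⟩, h⟩
  obtain ⟨⟨y₀, z₀⟩, hx, hmin⟩ :=
    hK.exists_isMinOn ⟨_, hmem y Z hy le_rfl⟩ continuous_snd.continuousOn
  have h₀ : S.LogFeasible A y₀ z₀ := hx.2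
  refine ⟨fun i => y₀ i.1, z₀, isSolution_iff.2 ⟨by rwa [h₀.expand_restrict], ?_⟩⟩
  intro y' z' h'
  rcases le_total z' Z with hz | hz
  · exact hmin (hmem y' z' h' hz)
  · exact hx.1.2.2.trans hz

theorem logFeasible_initial (hA : IsPCM A) {u : Fin n → ℝ} (hu : ∀ i, 0 < u i)
    (h0 : u 0 = 1) : (initial n).LogFeasible A (fun k => Real.log (u k)) (Ginf A u) where
  nonneg := Ginf_nonneg u
  normalized := by simp [h0]
  sub_ref k := by simp [initial]
  le_len p q _ := by
    refine ((dev_le_iff hA (fun k => Real.log (u k)) p q (Ginf_nonneg u)).1 ?_).1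
    simp only [Real.exp_log (hu _)]
    exact ⟨dev_le_Ginf u p q, dev_le_Ginf u q p⟩

/-! ### The binding digraph of a solution has a nontrivial component -/

theorem LogFeasible.adj_of_zero (hA : IsPCM A) {y : Fin n → ℝ} (h : S.LogFeasible A y 0)
    (p q : Fin n) : S.Tight A y 0 p q := by
  by_cases hr : S.ref p = S.ref q
  · exact .inl hr
  · have h1 := h.le_len p q hr
    have h2 := h.le_len q p (Ne.symm hr)
    have h3 := len_zero_add hA p q
    exact .inr (by linarith)

/-- Adding `ε r` loosens every binding constraint; a small `ε` keeps the others strict, and by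
continuity `z` can then decrease. As `r` is constant on classes, the constants `c` are preserved. -/
theorem exists_logFeasible_lt (hA : IsPCM A) {y : Fin n → ℝ} {z : ℝ} (hz : 0 < z)
    (h : S.LogFeasible A y z) (r : S.Vertex → ℝ)
    (hr : ∀ p q, S.ref p ≠ S.ref q → y q - y p = len A p q z →
      r (S.vertexOf q) < r (S.vertexOf p)) :
    ∃ y' z', S.LogFeasible A y' z' ∧ z' < z := by
  have h1 : ∀ᶠ ε in nhdsWithin (0 : ℝ) (Set.Ioi 0), ∀ p q, S.ref p ≠ S.ref q →
      y q - y p + ε * (r (S.vertexOf q) - r (S.vertexOf p)) < len A p q z := by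
    rw [Filter.eventually_all]; intro p
    rw [Filter.eventually_all]; intro q
    by_cases hpq : S.ref p = S.ref q
    · exact .of_forall fun _ hne => absurd hpq hne
    rcases (h.le_len p q hpq).eq_or_lt with e | hlt
    · filter_upwards [self_mem_nhdsWithin] with ε hε _
      have := hr p q hpq e
      rw [e]
      nlinarith [Set.mem_Ioi.1 hε]
    · have hc : Continuous fun ε : ℝ =>
          y q - y p + ε * (r (S.vertexOf q) - r (S.vertexOf p)) := by fun_prop
      have := (hc.tendsto 0).eventually_lt_const (u := len A p q z) (by simpa using hlt)
      filter_upwards [mem_nhdsWithin_of_mem_nhds this] with ε hε _ using hε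
  obtain ⟨ε, hε⟩ := h1.exists
  have h2 : ∀ᶠ t in nhdsWithin z (Set.Iio z), ∀ p q, S.ref p ≠ S.ref q →
      y q - y p + ε * (r (S.vertexOf q) - r (S.vertexOf p)) < len A p q (max t 0) := by
    rw [Filter.eventually_all]; intro p
    rw [Filter.eventually_all]; intro q
    by_cases hpq : S.ref p = S.ref q
    · exact .of_forall fun _ hne => absurd hpq hne
    have := ((continuous_len_max hA p q).tendsto z).eventually_const_lt
      (u := y q - y p + ε * (r (S.vertexOf q) - r (S.vertexOf p)))
      (by rw [max_eq_left hz.le]; exact hε p q hpq)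
    filter_upwards [mem_nhdsWithin_of_mem_nhds this] with t ht _ using ht
  obtain ⟨t, ht, htz⟩ := (h2.and self_mem_nhdsWithin).exists
  -- The subtracted constant restores the normalization; `t` itself might be negative.
  refine ⟨fun k => y k + ε * r (S.vertexOf k) - (y 0 + ε * r (S.vertexOf 0)), max t 0,
    ⟨le_max_right _ _, sub_self _, fun k => ?_, fun p q hpq => ?_⟩, max_lt htz hz⟩
  · have e : S.vertexOf (S.ref k) = S.vertexOf k := vertexOf_eq_iff.2 (S.ref_ref k)
    have := h.sub_ref k
    rw [e]
    linarith
  · have := ht p q hpq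
    linarith

theorem exists_ne_sameSCC (hA : IsPCM A) {w : S.Vertex → ℝ} {z : ℝ} (h : S.IsSolution A w z)
    (hs : ¬ StronglyConnected (S.bindingDigraph A w z)) :
    ∃ i j : S.Vertex, i ≠ j ∧ SameSCC (S.bindingDigraph A w z) i j := by
  obtain ⟨hf, hmin⟩ := isSolution_iff.1 h
  by_contra hcon
  have hacyc : ∀ i j : S.Vertex, SameSCC (S.bindingDigraph A w z) i j → i = j :=
    fun i j hij => by_contra fun hne => hcon ⟨i, j, hne, hij⟩
  rcases hf.nonneg.eq_or_lt with rfl | hz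
  · exact hs ((stronglyConnected_iff hf).2 fun p q => .single (hf.adj_of_zero hA p q))
  have hfin : Finite S.Vertex := Subtype.finite
  let R : S.Vertex → Set S.Vertex :=
    fun i => {k | Relation.ReflTransGen (S.bindingDigraph A w z).Adj i k}
  -- The potential counts reachable vertices. Without cycles it drops strictly along each arc, since
  -- the tail is not reachable from the head.
  obtain ⟨y', z', h', hlt⟩ := exists_logFeasible_lt hA hz hf (fun i => ((R i).ncard : ℝ)) (by
    intro p q hpq ht
    have hadj := adj_vertexOf_of_tight hf hpq ht
    refine Nat.cast_lt.2 (Set.ncard_lt_ncard ⟨fun k hk => .head hadj hk, fun hsub => ?_⟩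
      (Set.toFinite _))
    exact hadj.1 (hacyc _ _ ⟨.single hadj, hsub (show S.vertexOf p ∈ R _ from .refl)⟩))
  exact (hmin y' z' h').not_gt hlt

end

end Reduction

/-! ### Contraction steps and independence of choices -/

namespace Config

variable {n : ℕ} {A : Matrix (Fin n) (Fin n) ℝ} {γ γ' δ : Config n} {S : Reduction n}

/-- The logarithms of all weights of a configuration. -/
noncomputable def logWeights (γ : Config n) : Fin n → ℝ := γ.red.expand γ.w

theorem weights_eq (γ : Config n) : γ.weights = fun k => Real.exp (γ.logWeights k) := by
  funext k
  simp only [weights, logWeights, Reduction.expand, Real.exp_add]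

theorem exists_contracts (A : Matrix (Fin n) (Fin n) ℝ) (γ : Config n) :
    ∃ S : Reduction n, γ.Contracts A S := by
  let s : Setoid γ.red.Vertex :=
    { r := SameSCC (γ.digraph A)
      iseqv := ⟨fun _ => ⟨.refl, .refl⟩, fun h => ⟨h.2, h.1⟩,
        fun h h' => ⟨h.1.trans h'.1, h'.2.trans h.2⟩⟩ }
  let rep : Fin n → γ.red.Vertex := fun k => Quotient.out (Quotient.mk s (γ.red.vertexOf k))
  have hrep : ∀ k, SameSCC (γ.digraph A) (γ.red.vertexOf k) (rep k) := fun k =>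
    s.symm (Quotient.mk_out (s := s) (γ.red.vertexOf k))
  have hcongr : ∀ k m, SameSCC (γ.digraph A) (γ.red.vertexOf k) (γ.red.vertexOf m) →
      rep k = rep m := fun k m h => congrArg Quotient.out (Quotient.sound (s := s) h)
  have hidem : ∀ k, rep (rep k).1 = rep k := fun k => hcongr _ _ (by
    rw [Reduction.vertexOf_val]; exact s.symm (hrep k))
  refine ⟨⟨fun k => (rep k).1, fun k => congrArg Subtype.val (hidem k),
    fun k => γ.red.expand γ.w k - γ.red.expand γ.w (rep k).1, fun k => ?_⟩,
    fun k => ⟨rep k, rfl, hrep k⟩, fun k m h => congrArg Subtype.val (hcongr k m h),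
    fun k => rfl⟩
  simp only [hidem, sub_self]

theorem Contracts.c_sub (hc : γ.Contracts A S) {p q : Fin n} (hpq : S.ref p = S.ref q) :
    S.c p - S.c q = γ.logWeights p - γ.logWeights q := by
  rw [hc.2.2 p, hc.2.2 q, hpq, logWeights]; ring

variable [NeZero n]

/-- The pair stored in a configuration solves its reduced problem. -/
def Solved (A : Matrix (Fin n) (Fin n) ℝ) (γ : Config n) : Prop := γ.red.IsSolution A γ.w γ.z

theorem Solved.logFeasible (h : γ.Solved A) : γ.red.LogFeasible A γ.logWeights γ.z :=
  (Reduction.isSolution_iff.1 h).1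

theorem Solved.le (h : γ.Solved A) {y : Fin n → ℝ} {z : ℝ} (hy : γ.red.LogFeasible A y z) :
    γ.z ≤ z :=
  (Reduction.isSolution_iff.1 h).2 y z hy

theorem Solved.stops_iff (h : γ.Solved A) :
    γ.Stops A ↔ ∀ p q, γ.red.Reach A γ.logWeights γ.z p q :=
  Reduction.stronglyConnected_iff h.logFeasible

theorem Solved.eq_logWeights_of_stops (h : γ.Solved A) (hs : γ.Stops A) {y : Fin n → ℝ}
    (hy : γ.red.LogFeasible A y γ.z) : y = γ.logWeights :=
  h.logFeasible.eq_of_forall_reach hy (h.stops_iff.1 hs)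

theorem Contracts.ref_eq_iff (hc : γ.Contracts A S) (h : γ.Solved A) (p q : Fin n) :
    S.ref p = S.ref q ↔
      γ.red.Reach A γ.logWeights γ.z p q ∧ γ.red.Reach A γ.logWeights γ.z q p := by
  have key : SameSCC (γ.digraph A) (γ.red.vertexOf p) (γ.red.vertexOf q) ↔
      γ.red.Reach A γ.logWeights γ.z p q ∧ γ.red.Reach A γ.logWeights γ.z q p :=
    Reduction.sameSCC_iff h.logFeasible
  rw [← key]
  refine ⟨fun e => ?_, hc.2.1 p q⟩
  obtain ⟨i, hi, hpi⟩ := hc.1 p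
  obtain ⟨j, hj, hqj⟩ := hc.1 q
  obtain rfl : i = j := Subtype.ext (hi.symm.trans (e.trans hj))
  exact ⟨hpi.1.trans hqj.2, hqj.1.trans hpi.2⟩

theorem Contracts.ref_eq_of_ref_eq (hc : γ.Contracts A S) (h : γ.Solved A) {p q : Fin n}
    (hpq : γ.red.ref p = γ.red.ref q) : S.ref p = S.ref q :=
  (hc.ref_eq_iff h p q).2 ⟨.single (.inl hpq), .single (.inl hpq.symm)⟩

/-- A solution of a problem is feasible for the problem obtained by contraction. -/
theorem Contracts.logFeasible (hc : γ.Contracts A S) (h : γ.Solved A) :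
    S.LogFeasible A γ.logWeights γ.z where
  nonneg := h.logFeasible.nonneg
  normalized := h.logFeasible.normalized
  sub_ref k := (hc.2.2 k).symm
  le_len p q hpq := h.logFeasible.le_len p q fun e => hpq (hc.ref_eq_of_ref_eq h e)

/-- What is feasible for the contracted problem is feasible for the problem itself. -/
theorem Contracts.logFeasible_of_logFeasible (hA : IsPCM A) (hc : γ.Contracts A S)
    (h : γ.Solved A) {y : Fin n → ℝ} {z : ℝ} (hz : z ≤ γ.z) (hy : S.LogFeasible A y z) :
    γ.red.LogFeasible A y γ.z where
  nonneg := h.logFeasible.nonneg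
  normalized := hy.normalized
  sub_ref k := by
    have hk := hc.ref_eq_of_ref_eq h (γ.red.ref_ref k).symm
    rw [hy.sub_eq hk, hc.c_sub hk, h.logFeasible.sub_ref]
  le_len p q hpq := by
    -- Merged pairs inherit the differences, hence the inequalities, of the old solution; for the
    -- other pairs lengths are monotone in `z`.
    by_cases hr : S.ref q = S.ref p
    · rw [hy.sub_eq hr, hc.c_sub hr]
      exact h.logFeasible.le_len p q hpq
    · exact (hy.le_len p q (Ne.symm hr)).trans (len_mono hA p q hy.nonneg hz)

/-- Contraction forgets which of the solutions was taken. -/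
theorem Contracts.similar {T : Reduction n} (hs : γ.Solved A) (hs' : γ'.Solved A)
    (h : γ.red.Similar γ'.red) (hz : γ.z = γ'.z) (hc : γ.Contracts A S)
    (hc' : γ'.Contracts A T) : S.Similar T := by
  have hf := hs.logFeasible
  have hf' : γ.red.LogFeasible A γ'.logWeights γ.z := hz ▸ h.symm.logFeasible hs'.logFeasible
  constructor
  · intro p q
    rw [hc.ref_eq_iff hs, hc'.ref_eq_iff hs', ← h.reach_iff, ← h.reach_iff, ← hz]
    exact ⟨fun e => ⟨hf.reach_of_reach hf' e.1 e.2, hf.reach_of_reach hf' e.2 e.1⟩,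
      fun e => ⟨hf'.reach_of_reach hf e.1 e.2, hf'.reach_of_reach hf e.2 e.1⟩⟩
  · intro p q hpq
    have e := (hc.ref_eq_iff hs p q).1 hpq
    have hpq' : T.ref p = T.ref q := by
      rw [hc'.ref_eq_iff hs', ← h.reach_iff, ← h.reach_iff, ← hz]
      exact ⟨hf.reach_of_reach hf' e.1 e.2, hf.reach_of_reach hf' e.2 e.1⟩
    rw [hc.c_sub hpq, hc'.c_sub hpq', hf.sub_eq_sub_of_reach hf' e.2 e.1]

theorem Solved.z_eq_of_similar (hs : γ.Solved A) (hs' : γ'.Solved A)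
    (h : γ.red.Similar γ'.red) : γ.z = γ'.z :=
  le_antisymm (hs.le (h.symm.logFeasible hs'.logFeasible))
    (hs'.le (h.logFeasible hs.logFeasible))

theorem Solved.stops_of_similar (hs : γ.Solved A) (hs' : γ'.Solved A)
    (h : γ.red.Similar γ'.red) (hst : γ.Stops A) :
    γ'.Stops A ∧ γ'.logWeights = γ.logWeights := by
  have hz := hs.z_eq_of_similar hs' h
  have hf' : γ.red.LogFeasible A γ'.logWeights γ.z := hz ▸ h.symm.logFeasible hs'.logFeasible
  have he := hs.eq_logWeights_of_stops hst hf'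
  refine ⟨hs'.stops_iff.2 fun p q => ?_, he⟩
  rw [← h.reach_iff, he, ← hz]
  exact hs.stops_iff.1 hst p q

/-! ### Runs -/

theorem IsInitial.solved (h : γ.IsInitial A) : γ.Solved A := h.2

theorem Reachable.solved (h : γ.Reachable A) : γ.Solved A := by
  obtain ⟨γ₀, h₀, hr⟩ := h
  cases hr with
  | refl => exact h₀.solved
  | tail _ hst => exact hst.2.2

theorem Step.z_le (h : Step A γ γ') (hs : γ.Solved A) : γ'.z ≤ γ.z :=
  Solved.le (γ := γ') h.2.2 (h.2.1.logFeasible hs)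

/-- The number of vertices of the reduced network. -/
noncomputable def vertexCount (γ : Config n) : ℕ := {k | γ.red.ref k = k}.ncard

/-- New reference vertices are old ones, and two distinct old ones in the same component cannot both
survive. -/
theorem Step.vertexCount_lt (hA : IsPCM A) (h : Step A γ γ') (hs : γ.Solved A) :
    γ'.vertexCount < γ.vertexCount := by
  obtain ⟨i, j, hij, hscc⟩ := Reduction.exists_ne_sameSCC hA hs h.1
  refine Set.ncard_lt_ncard ⟨fun k hk => ?_, fun hsub => hij (Subtype.ext ?_)⟩ (Set.toFinite _)
  · obtain ⟨v, hv, -⟩ := h.2.1.1 k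
    rw [Set.mem_ofPred_eq] at hk ⊢
    rw [← hk, hv, v.2]
  · have hi : γ'.red.ref i.1 = i.1 := hsub i.2
    have hj : γ'.red.ref j.1 = j.1 := hsub j.2
    rw [← hi, ← hj]
    refine h.2.1.2.1 _ _ ?_
    rwa [Reduction.vertexOf_val, Reduction.vertexOf_val]

theorem exists_step (hA : IsPCM A) (hs : γ.Solved A) (hst : ¬ γ.Stops A) :
    ∃ γ', Step A γ γ' := by
  obtain ⟨S, hS⟩ := exists_contracts A γ
  obtain ⟨w, z, hw⟩ := (hS.logFeasible hs).exists_isSolution hA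
  exact ⟨⟨S, w, z⟩, hst, hS, hw⟩

theorem exists_isInitial (hA : IsPCM A) : ∃ γ : Config n, γ.IsInitial A := by
  obtain ⟨w, z, h⟩ := (Reduction.logFeasible_initial hA (u := fun _ => 1)
    (fun _ => one_pos) rfl).exists_isSolution hA
  exact ⟨⟨_, w, z⟩, rfl, h⟩

theorem exists_stops (hA : IsPCM A) (γ : Config n) (hs : γ.Solved A) :
    ∃ δ, Relation.ReflTransGen (Step A) γ δ ∧ δ.Stops A := by
  induction hm : γ.vertexCount using Nat.strong_induction_on generalizing γ with
  | _ m ih =>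
    by_cases hst : γ.Stops A
    · exact ⟨γ, .refl, hst⟩
    · obtain ⟨γ', h⟩ := exists_step hA hs hst
      obtain ⟨δ, hδ, hd⟩ := ih _ (hm ▸ h.vertexCount_lt hA hs) γ' h.2.2 rfl
      exact ⟨δ, .head h hδ, hd⟩

/-- Runs that start from similar problems and stop agree in their final weights. -/
theorem logWeights_eq_of_similar {γ₁ δ₁ γ₂ δ₂ : Config n} (hs₁ : γ₁.Solved A)
    (hs₂ : γ₂.Solved A) (h : γ₁.red.Similar γ₂.red)
    (hr₁ : Relation.ReflTransGen (Step A) γ₁ δ₁) (hr₂ : Relation.ReflTransGen (Step A) γ₂ δ₂)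
    (hst₁ : δ₁.Stops A) (hst₂ : δ₂.Stops A) : δ₂.logWeights = δ₁.logWeights := by
  induction hr₁ using Relation.ReflTransGen.head_induction_on generalizing γ₂ with
  | refl =>
    obtain ⟨hst, he⟩ := hs₁.stops_of_similar hs₂ h hst₁
    rcases hr₂.cases_head with rfl | ⟨_, hstep, -⟩
    · exact he
    · exact absurd hst hstep.1
  | head hstep₁ _ ih =>
    rcases hr₂.cases_head with rfl | ⟨_, hstep₂, hr₂'⟩
    · exact absurd (hs₂.stops_of_similar hs₁ h.symm hst₂).1 hstep₁.1
    · exact ih hstep₁.2.2 hstep₂.2.2 (hstep₁.2.1.similar hs₁ hs₂ h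
        (hs₁.z_eq_of_similar hs₂ h) hstep₂.2.1) hr₂'

/-- Feasibility is pulled back one contraction at a time, the optimal `z` never increasing along a
run. -/
theorem logFeasible_of_run (hA : IsPCM A) (hs : γ.Solved A)
    (hr : Relation.ReflTransGen (Step A) γ δ) : γ.red.LogFeasible A δ.logWeights γ.z := by
  induction hr using Relation.ReflTransGen.head_induction_on with
  | refl => exact hs.logFeasible
  | head hstep _ ih =>
    exact hstep.2.1.logFeasible_of_logFeasible hA hs (hstep.z_le hs) (ih hstep.2.2)

/-- The first solution already has the optimal value, and later weights stay feasible for it;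
stopping plays no role here. -/
theorem isLWAEOptimal_weights (hA : IsPCM A) (h : δ.Reachable A) :
    IsLWAEOptimal A δ.weights := by
  obtain ⟨γ, h₀, hr⟩ := h
  have hf := logFeasible_of_run hA h₀.solved hr
  rw [weights_eq]
  refine ⟨fun i => Real.exp_pos _, by simp only [hf.normalized, Real.exp_zero], ?_⟩
  intro u hu hu0
  have hle : γ.z ≤ Ginf A u := h₀.solved.le (by
    rw [h₀.1]; exact Reduction.logFeasible_initial hA hu hu0)
  refine le_trans ((Ginf_le_iff _ _).2 fun p q => ?_) hle
  by_cases hpq : p = q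
  · subst hpq
    rw [dev_self hA fun i => Real.exp_pos _]
    exact hf.nonneg
  · have hl := hf.le_len
    rw [h₀.1] at hl
    exact ((dev_le_iff hA _ p q hf.nonneg).2 ⟨hl p q hpq, hl q p (Ne.symm hpq)⟩).1

/-- A vector that dominates the result of a run is feasible for all problems of the run. -/
theorem logFeasible_of_dev_le (hA : IsPCM A) {y : Fin n → ℝ} (h0 : y 0 = 0)
    (hy : ∀ p q, dev A (fun k => Real.exp (y k)) p q ≤ dev A δ.weights p q)
    (hγ : γ.IsInitial A) (hr : Relation.ReflTransGen (Step A) γ γ')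
    (hr' : Relation.ReflTransGen (Step A) γ' δ) : γ'.red.LogFeasible A y γ'.z := by
  -- Across classes of `β`, the final weights have deviations at most `β.z`, and so has the
  -- dominating vector.
  have hlen : ∀ β : Config n, β.Solved A → Relation.ReflTransGen (Step A) β δ →
      ∀ p q, β.red.ref p ≠ β.red.ref q → y q - y p ≤ len A p q β.z := by
    intro β hs hβ p q hpq
    have hf := logFeasible_of_run hA hs hβ
    have hd := (dev_le_iff hA _ p q hf.nonneg).2
      ⟨hf.le_len p q hpq, hf.le_len q p (Ne.symm hpq)⟩
    rw [← weights_eq] at hd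
    exact ((dev_le_iff hA y p q hf.nonneg).1
      ⟨(hy p q).trans hd.1, (hy q p).trans hd.2⟩).1
  induction hr with
  | refl =>
    refine ⟨hγ.solved.logFeasible.nonneg, h0, fun k => ?_, hlen γ hγ.solved hr'⟩
    rw [hγ.1]
    simp [Reduction.initial]
  | @tail β β' hβ hstep ih =>
    have hs : β.Solved A := Reachable.solved ⟨γ, hγ, hβ⟩
    have hf := ih (.head hstep hr')
    refine ⟨(Solved.logFeasible (γ := β') hstep.2.2).nonneg, h0, fun k => ?_,
      hlen β' hstep.2.2 hr'⟩
    have hk : β'.red.ref k = β'.red.ref (β'.red.ref k) := (β'.red.ref_ref k).symm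
    -- Both vertices lie in one component of the binding digraph of `β`, so rigidity forces the
    -- recomputed constant on `y`.
    have e := (hstep.2.1.ref_eq_iff hs _ _).1 hk
    rw [hs.logFeasible.sub_eq_sub_of_reach hf e.2 e.1, ← hstep.2.1.c_sub hk, β'.red.c_ref,
      sub_zero]

theorem isParetoOptimal_weights (hA : IsPCM A) (h : δ.Reachable A) (hst : δ.Stops A) :
    IsParetoOptimal A δ.weights := by
  have hs := h.solved
  obtain ⟨γ, h₀, hr⟩ := h
  refine ⟨fun i => by rw [weights_eq]; exact Real.exp_pos _, ?_⟩
  rintro ⟨u, hu, hle, i, j, hlt⟩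
  have he : (fun k => Real.exp (Real.log (u k / u 0))) = fun k => u k / u 0 :=
    funext fun k => Real.exp_log (div_pos (hu k) (hu 0))
  -- Deviations are scale-invariant, so `u` may be normalized to have first coordinate `1`.
  have hy := logFeasible_of_dev_le (y := fun k => Real.log (u k / u 0)) hA
    (by simp [div_self (hu 0).ne'])
    (fun p q => by rw [he, dev_div_const u (hu 0).ne']; exact hle p q) h₀ hr .refl
  have heq : (fun k => u k / u 0) = δ.weights := by
    rw [weights_eq, ← hs.eq_logWeights_of_stops hst hy, he]
  rw [← heq, dev_div_const u (hu 0).ne'] at hlt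
  exact lt_irrefl _ hlt

end Config

end LWAE

theorem mainTheorem2 {n : ℕ} [NeZero n] (A : Matrix (Fin n) (Fin n) ℝ) (hA : LWAE.IsPCM A) :
    -- the algorithm can be started, and it never gets stuck, whatever is chosen
    (∃ γ : LWAE.Config n, γ.IsInitial A) ∧
    (∀ γ : LWAE.Config n, γ.Reachable A → ¬ γ.Stops A →
      (∃ S : LWAE.Reduction n, γ.Contracts A S) ∧
      ∀ S : LWAE.Reduction n, γ.Contracts A S →
        ∃ (w : S.Vertex → ℝ) (z : ℝ), S.IsSolution A w z) ∧
    -- every run is finite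
    (¬ ∃ run : ℕ → LWAE.Config n,
      (run 0).IsInitial A ∧ ∀ m : ℕ, (run m).Step A (run (m + 1))) ∧
    -- when a run stops, the last reduced problem has a single solution
    (∀ γ : LWAE.Config n, γ.Reachable A → γ.Stops A →
      ∀ (w : γ.red.Vertex → ℝ) (z : ℝ), γ.red.IsSolution A w z → w = γ.w ∧ z = γ.z) ∧
    -- all runs return the same vector, which is LWAE-optimal and Pareto-optimal
    ∃ v : Fin n → ℝ, (∀ u : Fin n → ℝ, LWAE.IsOutput A u ↔ u = v) ∧
      LWAE.IsLWAEOptimal A v ∧ LWAE.IsParetoOptimal A v := by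
  refine ⟨LWAE.Config.exists_isInitial hA, fun γ hγ _ => ⟨LWAE.Config.exists_contracts A γ,
    fun S hS => (hS.logFeasible hγ.solved).exists_isSolution hA⟩, ?_, ?_, ?_⟩
  · rintro ⟨run, h0, hstep⟩
    have hs : ∀ m, (run m).Solved A := fun m => by
      cases m with
      | zero => exact h0.solved
      | succ m => exact (hstep m).2.2
    have hanti : StrictAnti fun m => (run m).vertexCount :=
      strictAnti_nat_of_succ_lt fun m => (hstep m).vertexCount_lt hA (hs m)
    exact not_strictAnti_of_wellFoundedLT _ hanti
  · intro γ hγ hst w z hw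
    have hs := hγ.solved
    have hf := (LWAE.Reduction.isSolution_iff.1 hw).1
    obtain rfl : z = γ.z := le_antisymm
      ((LWAE.Reduction.isSolution_iff.1 hw).2 _ _ hs.logFeasible) (hs.le hf)
    exact ⟨LWAE.Reduction.expand_injective (hs.eq_logWeights_of_stops hst hf), rfl⟩
  · obtain ⟨γ, h₀⟩ := LWAE.Config.exists_isInitial hA
    obtain ⟨δ, hr, hst⟩ := LWAE.Config.exists_stops hA γ h₀.solved
    have hδ : δ.Reachable A := ⟨γ, h₀, hr⟩
    refine ⟨δ.weights, fun u => ⟨?_, fun e => ⟨δ, hδ, hst, e⟩⟩,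
      LWAE.Config.isLWAEOptimal_weights hA hδ, LWAE.Config.isParetoOptimal_weights hA hδ hst⟩
    rintro ⟨δ', ⟨γ', h₀', hr'⟩, hst', rfl⟩
    rw [LWAE.Config.weights_eq, LWAE.Config.weights_eq,
      LWAE.Config.logWeights_eq_of_similar h₀.solved h₀'.solved
        (by rw [h₀.1, h₀'.1]; exact .refl _) hr hr' hst hst']
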